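/- All graphs are finite, connected, undirected and simple, and $d_G$ denotes the shortest-path distance of a graph $G$. The disk $D(v,r)$ ($r\in\mathbb{N}$) is the set of vertices $u$ with $d_G(u,v)\le r$. $G$ is a Helly graph if every family of pairwise intersecting disks of $G$ has a common vertex. The hyperbolicity $hb(G)$ is the smallest $\delta\ge 0$ such that for any four vertices $u,v,w,x$ of $G$ the two larger of the sums $d_G(u,v)+d_G(w,x)$, $d_G(u,w)+d_G(v,x)$, $d_G(u,x)+d_G(v,w)$ differ by at most $2\delta$. A graph $H$ is an isometric subgraph of $G$ if it is isomorphic to an induced subgraph of $G$ in which the distance between any two vertices equals their distance in $G$. For an integer $k\ge 0$ let $H_1^k$, $H_2^k$, $H_3^k$ be the subgraphs of the King-grid on $\mathbb{Z}^2$ (distinct points $(x,y)$ and $(x',y')$ are adjacent iff $|x-x'|\le 1$ and $|y-y'|\le 1$) induced by the following sets of vertices: - $H_1^k$: $\{(x,y)\in\mathbb{Z}^2 : |x|+|y|\le k\}$; - $H_2^k$: $\{(x,y)\in\mathbb{Z}^2 : |x|+|y-\tfrac12|\le k+\tfrac12\}\cup\{(-k-1,0),\,(k+1,0)\}$; - $H_3^k$: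 $\{(x,y)\in\mathbb{Z}^2 : |x-\tfrac12|+|y-\tfrac12|\le k+1\}\cup\{(-k-1,0),\,(0,k+2),\,(k+2,1),\,(1,-k-1)\}$. **Theorem.** Let $G$ be a Helly graph and $k$ a non-negative integer. Then 1. $hb(G)\le k$ if and only if $G$ does not contain $H_2^k$ as an isometric subgraph; 2. $hb(G)\le k+\tfrac12$ if and only if $G$ contains neither $H_1^{k+1}$ nor $H_3^k$ as an isometric subgraph. -/

import Mathlib

namespace HellyHyp

variable {V W : Type*}

/-- The disk `D(v, r)`: all vertices at distance at most `r` from `v`. -/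
def disk (G : SimpleGraph V) (v : V) (r : ℕ) : Set V := {u | G.dist v u ≤ r}

/-- A family of sets has the Helly property if every pairwise intersecting subfamily has a
common point. -/
def HellyProperty (F : Set (Set V)) : Prop :=
  ∀ F' ⊆ F, (∀ A ∈ F', ∀ B ∈ F', (A ∩ B).Nonempty) → (⋂₀ F').Nonempty

/-- A graph is Helly if the family of all its disks has the Helly property. -/
def IsHelly (G : SimpleGraph V) : Prop :=
  HellyProperty {D : Set V | ∃ (v : V) (r : ℕ), D = disk G v r}

/-- The four-point condition: the two larger of the three distance sums of any four vertices
differ by at most `2 * δ`. Since the quadruple is arbitrary, it suffices to name the largest sum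
first and the second largest sum second. -/
def IsHyperbolic (G : SimpleGraph V) (δ : ℝ) : Prop :=
  ∀ u v w x : V,
    G.dist u x + G.dist v w ≤ G.dist u w + G.dist v x →
    G.dist u w + G.dist v x ≤ G.dist u v + G.dist w x →
    ((G.dist u v + G.dist w x : ℕ) : ℝ) - ((G.dist u w + G.dist v x : ℕ) : ℝ) ≤ 2 * δ

/-- The hyperbolicity of a graph: the smallest `δ ≥ 0` for which it is `δ`-hyperbolic
(for finite graphs the infimum is attained, see `isLeast_hb`). -/
noncomputable def hb (G : SimpleGraph V) : ℝ := sInf {δ : ℝ | 0 ≤ δ ∧ IsHyperbolic G δ}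

theorem isLeast_hb [Finite V] (G : SimpleGraph V) :
    IsLeast {δ : ℝ | 0 ≤ δ ∧ IsHyperbolic G δ} (hb G) := by
  have hbdd : BddBelow {δ : ℝ | 0 ≤ δ ∧ IsHyperbolic G δ} := ⟨0, fun δ h => h.1⟩
  have hne : {δ : ℝ | 0 ≤ δ ∧ IsHyperbolic G δ}.Nonempty := by
    obtain ⟨M, hM⟩ := (Set.finite_range
      (fun p : V × V × V × V => G.dist p.1 p.2.1 + G.dist p.2.2.1 p.2.2.2)).bddAbove
    refine ⟨M, Nat.cast_nonneg M, fun u v w x _ _ => ?_⟩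
    have h1 : G.dist u v + G.dist w x ≤ M := hM ⟨(u, v, w, x), rfl⟩
    have h2 : ((G.dist u v + G.dist w x : ℕ) : ℝ) ≤ M := by exact_mod_cast h1
    have h3 : (0 : ℝ) ≤ ((G.dist u w + G.dist v x : ℕ) : ℝ) := Nat.cast_nonneg _
    have h4 : (0 : ℝ) ≤ M := Nat.cast_nonneg M
    linarith
  refine ⟨⟨le_csInf hne fun δ h => h.1, fun u v w x h1 h2 => ?_⟩, fun δ h => csInf_le hbdd h⟩
  have h : (((G.dist u v + G.dist w x : ℕ) : ℝ) - ((G.dist u w + G.dist v x : ℕ) : ℝ)) / 2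
      ≤ hb G :=
    le_csInf hne fun δ hδ => by linarith [hδ.2 u v w x h1 h2]
  linarith

/-- `G` contains `H` as an isometric subgraph: some induced subgraph of `G` is isomorphic to `H`,
and distances in this induced subgraph agree with distances in `G`. -/
def ContainsIsometric (G : SimpleGraph V) (H : SimpleGraph W) : Prop :=
  ∃ A : Set V, (∀ u v : A, (G.induce A).dist u v = G.dist (u : V) (v : V)) ∧
    Nonempty (H ≃g G.induce A)

/-- The strong product of two graphs. -/
def strongProduct (G : SimpleGraph V) (H : SimpleGraph W) : SimpleGraph (V × W) where
  Adj a b := a ≠ b ∧ (a.1 = b.1 ∨ G.Adj a.1 b.1) ∧ (a.2 = b.2 ∨ H.Adj a.2 b.2)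
  symm := ⟨fun _ _ h =>
    ⟨h.1.symm, h.2.1.imp Eq.symm G.adj_symm, h.2.2.imp Eq.symm H.adj_symm⟩⟩
  loopless := ⟨fun _ h => h.1 rfl⟩

/-- The two-way infinite King-grid, the strong product of two copies of the two-way infinite path
(`SimpleGraph.hasse ℤ` joins consecutive integers). -/
noncomputable def kingGrid : SimpleGraph (ℤ × ℤ) :=
  strongProduct (SimpleGraph.hasse ℤ) (SimpleGraph.hasse ℤ)

theorem kingGrid_adj (a b : ℤ × ℤ) :
    kingGrid.Adj a b ↔ a ≠ b ∧ |a.1 - b.1| ≤ 1 ∧ |a.2 - b.2| ≤ 1 := by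
  have key : ∀ m n : ℤ, (m = n ∨ (SimpleGraph.hasse ℤ).Adj m n) ↔ |m - n| ≤ 1 := by
    intro m n
    rw [SimpleGraph.hasse_adj, Order.covBy_iff_add_one_eq, Order.covBy_iff_add_one_eq, abs_le]
    omega
  simp only [kingGrid, strongProduct, key]

/-- The vertex set of `H₁ᵏ`: the integer points of the diamond of radius `k` about the origin.
The corners are `(±k, 0)` and `(0, ±k)`. -/
def H1Set (k : ℕ) : Set (ℤ × ℤ) := {p | |p.1| + |p.2| ≤ k}

/-- The vertex set of `H₂ᵏ`: the integer points of the diamond of radius `k + 1/2` about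
`(0, 1/2)`, together with the two extreme vertices `(±(k + 1), 0)`. The other two extreme
vertices are `(0, k + 1)` and `(0, -k)`. -/
def H2Set (k : ℕ) : Set (ℤ × ℤ) :=
  {p | 2 * |p.1| + |2 * p.2 - 1| ≤ 2 * k + 1} ∪ {(-(k + 1 : ℤ), 0), ((k + 1 : ℤ), 0)}

/-- The vertex set of `H₃ᵏ`: the integer points of the diamond of radius `k + 1` about
`(1/2, 1/2)`, together with four extreme vertices. -/
def H3Set (k : ℕ) : Set (ℤ × ℤ) :=
  {p | |2 * p.1 - 1| + |2 * p.2 - 1| ≤ 2 * k + 2} ∪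
    {(-(k + 1 : ℤ), 0), (0, (k + 2 : ℤ)), ((k + 2 : ℤ), 1), (1, -(k + 1 : ℤ))}

/-- The graph `H₁ᵏ`, an induced subgraph of the King-grid. -/
noncomputable def H1 (k : ℕ) : SimpleGraph (H1Set k) := kingGrid.induce (H1Set k)

/-- The graph `H₂ᵏ`, an induced subgraph of the King-grid. -/
noncomputable def H2 (k : ℕ) : SimpleGraph (H2Set k) := kingGrid.induce (H2Set k)

/-- The graph `H₃ᵏ`, an induced subgraph of the King-grid. -/
noncomputable def H3 (k : ℕ) : SimpleGraph (H3Set k) := kingGrid.induce (H3Set k)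

end HellyHyp

/-!
The King-grid on `ℤ × ℤ` carries the Chebyshev distance, and the vertex sets of `H1 k`, `H2 k` and
`H3 k` are geodesic in it (`isGeodesicSet_H1Set` and its analogues). A copy of one of these graphs in
`G` is therefore isometric as soon as distances in `G` between the images are Chebyshev distances
(`IsGeodesicSet.containsIsometric_iff`). In such a copy the four corners violate the four-point
condition, which gives the easy direction.

For the converse, let `u, v, w, x` be vertices for which `d(u,v) + d(w,x)` exceeds the other two
sums by too much. In the real setting their tight span contains a square in the `ℓ₁` metric, with
four tails leading to `u, v, w, x`. Its integer version consists of one of the three vertex sets in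
the King-grid, with `u, v, w, x` placed at natural heights over its four corners, those of `u` and
`v` being opposite. Such heights have to preserve the diagonal distances `d(u,v)`, `d(w,x)` and
must not decrease the others. This is a small system of linear inequalities whose only integrality
obstruction is a parity; the parity decides between the two orientations of `H2 k`, and between `H1 (k + 1)` and
`H3 k` (`exists_heights_H2`, `exists_heights_H1_or_H3`).

Given the heights, the placement is a 1-Lipschitz map from four points to `G`. In a Helly graph it
extends to all points of the set, one point at a time: the disks in which a new image has to
lie pairwise intersect (`IsHelly.exists_extension`). Any two points of the set lie on a geodesic
between two corners whose distance is preserved, so the extension cannot shorten distances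
(`IsHelly.containsIsometric_of_anchors`) and is the required isometric copy.
-/

namespace HellyHyp

/-! ### The distance of the King-grid -/

/-- The Chebyshev distance on `ℤ × ℤ`, which is the distance of the King-grid. -/
def linf (p q : ℤ × ℤ) : ℕ := max (p.1 - q.1).natAbs (p.2 - q.2).natAbs

theorem linf_self (p : ℤ × ℤ) : linf p p = 0 := by simp [linf]

theorem linf_comm (p q : ℤ × ℤ) : linf p q = linf q p := by
  unfold linf; omega

theorem linf_triangle (p q r : ℤ × ℤ) : linf p r ≤ linf p q + linf q r := by
  unfold linf; omega

theorem linf_eq_zero {p q : ℤ × ℤ} (h : linf p q = 0) : p = q := by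
  unfold linf at h
  ext <;> omega

theorem kingGrid_adj_iff_linf (p q : ℤ × ℤ) : kingGrid.Adj p q ↔ linf p q = 1 := by
  rw [kingGrid_adj, ne_eq, Prod.ext_iff, Int.abs_eq_natAbs, Int.abs_eq_natAbs]
  unfold linf
  omega

/-- A set of grid points is geodesic if any two of its points can be joined, inside the set, by a
path whose length is their Chebyshev distance; it suffices to have one intermediate point for each
pair of non-adjacent points. -/
def IsGeodesicSet (S : Set (ℤ × ℤ)) : Prop :=
  ∀ p ∈ S, ∀ q ∈ S, 2 ≤ linf p q → ∃ r ∈ S, r ≠ p ∧ r ≠ q ∧ linf p r + linf r q = linf p q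

/-- Chebyshev distance is a lower bound for the distance in any induced subgraph of the King-grid. -/
theorem linf_le_length {S : Set (ℤ × ℤ)} {a b : S} (w : (kingGrid.induce S).Walk a b) :
    linf a b ≤ w.length := by
  induction w with
  | nil => simp [linf_self]
  | @cons u v z h _ ih =>
    have h1 : linf u v = 1 := (kingGrid_adj_iff_linf _ _).1 h
    rw [SimpleGraph.Walk.length_cons]
    exact (linf_triangle u v z).trans (by omega)

theorem IsGeodesicSet.exists_walk {S : Set (ℤ × ℤ)} (hS : IsGeodesicSet S) (n : ℕ) (a b : S)
    (hab : linf a b = n) : ∃ w : (kingGrid.induce S).Walk a b, w.length = n := by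
  induction n using Nat.strong_induction_on generalizing a b with
  | _ n ih =>
  rcases Nat.lt_or_ge n 2 with hn | hn
  · interval_cases n
    · obtain rfl : a = b := Subtype.ext (linf_eq_zero hab)
      exact ⟨.nil, rfl⟩
    · have hadj : (kingGrid.induce S).Adj a b := (kingGrid_adj_iff_linf _ _).2 hab
      exact ⟨hadj.toWalk, rfl⟩
  · obtain ⟨r, hr, hra, hrb, h⟩ := hS a a.2 b b.2 (hab ▸ hn)
    have h1 : linf a r ≠ 0 := fun h0 => hra (linf_eq_zero h0).symm
    have h2 : linf r b ≠ 0 := fun h0 => hrb (linf_eq_zero h0)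
    obtain ⟨w₁, hw₁⟩ := ih (linf a r) (by omega) a ⟨r, hr⟩ rfl
    obtain ⟨w₂, hw₂⟩ := ih (linf r b) (by omega) ⟨r, hr⟩ b rfl
    exact ⟨w₁.append w₂, by rw [SimpleGraph.Walk.length_append, hw₁, hw₂, h, hab]⟩

theorem IsGeodesicSet.dist_induce {S : Set (ℤ × ℤ)} (hS : IsGeodesicSet S) (a b : S) :
    (kingGrid.induce S).dist a b = linf a b := by
  obtain ⟨w, hw⟩ := hS.exists_walk _ a b rfl
  refine le_antisymm (hw ▸ SimpleGraph.dist_le w) ?_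
  obtain ⟨w', hw'⟩ := w.reachable.exists_walk_length_eq_dist
  exact hw' ▸ linf_le_length w'

/-! ### Isometric copies of subgraphs of the King-grid -/

theorem dist_le_of_iso {V W : Type*} {G : SimpleGraph V} {H : SimpleGraph W} (e : G ≃g H)
    {a b : V} (h : G.Reachable a b) : H.dist (e a) (e b) ≤ G.dist a b := by
  obtain ⟨w, hw⟩ := h.exists_walk_length_eq_dist
  rw [← hw, ← SimpleGraph.Walk.length_map e.toHom w]
  exact SimpleGraph.dist_le _

theorem dist_iso {V W : Type*} {G : SimpleGraph V} {H : SimpleGraph W} (e : G ≃g H)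
    (a b : V) : H.dist (e a) (e b) = G.dist a b := by
  by_cases h : G.Reachable a b
  · refine le_antisymm (dist_le_of_iso e h) ?_
    simpa using dist_le_of_iso e.symm (e.reachable_iff.2 h)
  · rw [SimpleGraph.dist_eq_zero_of_not_reachable h,
      SimpleGraph.dist_eq_zero_of_not_reachable (fun h' => h (e.reachable_iff.1 h'))]

/-- Containing an isometric copy of a geodesic subgraph of the King-grid only requires a map which is
isometric for the Chebyshev distance: injectivity, adjacency and the distances inside the image
follow. -/
theorem IsGeodesicSet.containsIsometric_iff {V : Type*} {G : SimpleGraph V} {S : Set (ℤ × ℤ)}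
    (hS : IsGeodesicSet S) :
    ContainsIsometric G (kingGrid.induce S) ↔
      ∃ f : S → V, ∀ a b, G.dist (f a) (f b) = linf a b := by
  constructor
  · rintro ⟨A, hA, ⟨e⟩⟩
    refine ⟨fun a => (e a : V), fun a b => ?_⟩
    rw [← hA, dist_iso, hS.dist_induce]
  · rintro ⟨f, hf⟩
    have hinj : Function.Injective f := by
      intro a b hab
      have h := hf a b
      rw [hab, SimpleGraph.dist_self] at h
      exact Subtype.ext (linf_eq_zero h.symm)
    let e : kingGrid.induce S ≃g G.induce (Set.range f) :=
      { Equiv.ofInjective f hinj with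
        map_rel_iff' := by
          intro a b
          change G.Adj (f a) (f b) ↔ kingGrid.Adj a b
          rw [← SimpleGraph.dist_eq_one_iff_adj, hf, kingGrid_adj_iff_linf] }
    refine ⟨Set.range f, ?_, ⟨e⟩⟩
    rintro ⟨_, a, rfl⟩ ⟨_, b, rfl⟩
    exact (dist_iso e a b).trans ((hS.dist_induce a b).trans (hf a b).symm)

/-! ### The sets `H1Set`, `H2Set` and `H3Set` are geodesic -/

/-- The grid points in a rectangle whose sides are parallel to the two diagonals of the grid. -/
def diamond (a b c d : ℤ) : Set (ℤ × ℤ) :=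
  {p | a ≤ p.1 + p.2 ∧ p.1 + p.2 ≤ b ∧ c ≤ p.1 - p.2 ∧ p.1 - p.2 ≤ d}

theorem mem_diamond {a b c d x y : ℤ} :
    (x, y) ∈ diamond a b c d ↔ a ≤ x + y ∧ x + y ≤ b ∧ c ≤ x - y ∧ x - y ≤ d := Iff.rfl

/-- In the coordinates `x + y` and `x - y`, a King-grid path can move from `p` towards `q`
monotonically: it changes both coordinates by one if both still differ, and otherwise the only
differing one by two. -/
theorem exists_step_between (p q : ℤ × ℤ) (h : 2 ≤ linf p q) :
    ∃ r, r ≠ p ∧ r ≠ q ∧ linf p r + linf r q = linf p q ∧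
      ∀ a b c d, p ∈ diamond a b c d → q ∈ diamond a b c d → r ∈ diamond a b c d := by
  obtain ⟨x, y⟩ := p
  obtain ⟨z, w⟩ := q
  have key : ∃ s t : ℤ, ¬(s = x ∧ t = y) ∧ ¬(s = z ∧ t = w) ∧
      linf (x, y) (s, t) + linf (s, t) (z, w) = linf (x, y) (z, w) ∧
      min (x + y) (z + w) ≤ s + t ∧ s + t ≤ max (x + y) (z + w) ∧
      min (x - y) (z - w) ≤ s - t ∧ s - t ≤ max (x - y) (z - w) := by
    unfold linf at h ⊢
    dsimp only at h ⊢
    rcases lt_trichotomy (x + y) (z + w) with h1 | h1 | h1 <;>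
      rcases lt_trichotomy (x - y) (z - w) with h2 | h2 | h2
    · exact ⟨x + 1, y, by omega⟩
    · exact ⟨x + 1, y + 1, by omega⟩
    · exact ⟨x, y + 1, by omega⟩
    · exact ⟨x + 1, y - 1, by omega⟩
    · omega
    · exact ⟨x - 1, y + 1, by omega⟩
    · exact ⟨x, y - 1, by omega⟩
    · exact ⟨x - 1, y - 1, by omega⟩
    · exact ⟨x - 1, y, by omega⟩
  obtain ⟨s, t, h1, h2, h3, h4⟩ := key
  refine ⟨(s, t), by simpa using h1, by simpa using h2, h3, fun a b c d hp hq => ?_⟩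
  rw [mem_diamond] at *
  omega

theorem isGeodesicSet_diamond (a b c d : ℤ) : IsGeodesicSet (diamond a b c d) := by
  intro p hp q hq h
  obtain ⟨r, h1, h2, h3, h4⟩ := exists_step_between p q h
  exact ⟨r, h4 a b c d hp hq, h1, h2, h3⟩

/-- A point `c` can be added to a geodesic set `S` if a geodesic from `c` to each point of `S` has
its first step in `S`. -/
theorem IsGeodesicSet.insert {S : Set (ℤ × ℤ)} (hS : IsGeodesicSet S) (c : ℤ × ℤ)
    (hc : ∀ p ∈ S, 2 ≤ linf c p → ∃ r ∈ S, linf c r = 1 ∧ linf c r + linf r p = linf c p) :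
    IsGeodesicSet (Insert.insert c S) := by
  have hc' : ∀ p ∈ S, 2 ≤ linf c p →
      ∃ r ∈ S, r ≠ c ∧ r ≠ p ∧ linf c r + linf r p = linf c p := by
    intro p hp h
    obtain ⟨r, hr, h1, h2⟩ := hc p hp h
    refine ⟨r, hr, ?_, ?_, h2⟩ <;> rintro rfl
    · rw [linf_self] at h1
      omega
    · omega
  rintro p (rfl | hp) q (rfl | hq) h
  · rw [linf_self] at h
    omega
  · obtain ⟨r, hr, h1⟩ := hc' q hq h
    exact ⟨r, Or.inr hr, h1⟩
  · obtain ⟨r, hr, h1, h2, h3⟩ := hc' p hp (by rwa [linf_comm])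
    exact ⟨r, Or.inr hr, h2, h1, by rw [linf_comm p r, linf_comm r q, linf_comm p q]; omega⟩
  · obtain ⟨r, hr, h1⟩ := hS p hp q hq h
    exact ⟨r, Or.inr hr, h1⟩

theorem H1Set_eq (k : ℕ) : H1Set k = diamond (-k) k (-k) k := by
  ext ⟨x, y⟩
  change |x| + |y| ≤ _ ↔ _
  rw [mem_diamond, Int.abs_eq_natAbs, Int.abs_eq_natAbs]
  omega

theorem H2Set_eq (k : ℕ) : H2Set k =
    insert (-(k + 1 : ℤ), 0) (insert ((k + 1 : ℤ), 0) (diamond (-k) (k + 1) (-(k + 1)) k)) := by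
  ext ⟨x, y⟩
  simp only [H2Set, Set.mem_union, Set.mem_ofPred_eq, Set.mem_insert_iff, Set.mem_singleton_iff,
    Prod.mk.injEq, Int.abs_eq_natAbs, mem_diamond]
  omega

theorem H3Set_eq (k : ℕ) : H3Set k =
    insert (-(k + 1 : ℤ), 0) (insert (0, (k + 2 : ℤ)) (insert ((k + 2 : ℤ), 1)
      (insert (1, -(k + 1 : ℤ)) (diamond (-k) (k + 2) (-(k + 1)) (k + 1))))) := by
  ext ⟨x, y⟩
  simp only [H3Set, Set.mem_union, Set.mem_ofPred_eq, Set.mem_insert_iff, Set.mem_singleton_iff,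
    Prod.mk.injEq, Int.abs_eq_natAbs, mem_diamond]
  omega

/-- A variant of `IsGeodesicSet.insert` with two explicit neighbours `r` and `s` of the new
point. -/
theorem IsGeodesicSet.insert_of_two {S : Set (ℤ × ℤ)} (hS : IsGeodesicSet S) {c r s : ℤ × ℤ}
    (hr : r ∈ S) (hs : s ∈ S) (hcr : linf c r = 1) (hcs : linf c s = 1)
    (hc : ∀ x y, (x, y) ∈ S → 2 ≤ linf c (x, y) →
      1 + linf r (x, y) = linf c (x, y) ∨ 1 + linf s (x, y) = linf c (x, y)) :
    IsGeodesicSet (Insert.insert c S) := by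
  refine hS.insert c ?_
  rintro ⟨x, y⟩ hp h
  rcases hc x y hp h with h | h
  · exact ⟨r, hr, hcr, by rw [hcr, h]⟩
  · exact ⟨s, hs, hcs, by rw [hcs, h]⟩

theorem isGeodesicSet_H1Set (k : ℕ) : IsGeodesicSet (H1Set k) :=
  H1Set_eq k ▸ isGeodesicSet_diamond _ _ _ _

/-- Each extreme vertex outside the diamond has two neighbours in it such that every vertex further
away is reached by a geodesic through one of them. The same argument applies to `H3Set`. -/
theorem isGeodesicSet_H2Set (k : ℕ) : IsGeodesicSet (H2Set k) := by
  rw [H2Set_eq]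
  refine ((isGeodesicSet_diamond _ _ _ _).insert_of_two (r := (k, 0)) (s := (k, 1))
    ?_ ?_ ?_ ?_ ?_).insert_of_two (r := (-k, 0)) (s := (-k, 1)) ?_ ?_ ?_ ?_ ?_ <;>
  simp only [linf, Set.mem_insert_iff, Prod.mk.injEq, mem_diamond] <;> omega

theorem isGeodesicSet_H3Set (k : ℕ) : IsGeodesicSet (H3Set k) := by
  rw [H3Set_eq]
  refine ((((isGeodesicSet_diamond _ _ _ _).insert_of_two (r := (0, -k)) (s := (1, -k))
    ?_ ?_ ?_ ?_ ?_).insert_of_two (r := (k + 1, 0)) (s := (k + 1, 1)) ?_ ?_ ?_ ?_ ?_).insert_of_two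
    (r := (0, k + 1)) (s := (1, k + 1)) ?_ ?_ ?_ ?_ ?_).insert_of_two
    (r := (-k, 0)) (s := (-k, 1)) ?_ ?_ ?_ ?_ ?_ <;>
  simp only [linf, Set.mem_insert_iff, Prod.mk.injEq, mem_diamond] <;> omega

/-! ### Extension of 1-Lipschitz maps into Helly graphs -/

variable {V X : Type*} {G : SimpleGraph V}

theorem disk_inter_disk_nonempty (hG : G.Connected) {a b : V}
    {r s : ℕ} (h : G.dist a b ≤ r + s) : (disk G a r ∩ disk G b s).Nonempty := by
  obtain ⟨w, hw⟩ := hG.exists_walk_length_eq_dist a b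
  refine ⟨w.getVert r, ?_, ?_⟩
  · change G.dist a _ ≤ r
    exact (SimpleGraph.dist_le (w.take r)).trans (by simp [SimpleGraph.Walk.take_length])
  · change G.dist b _ ≤ s
    rw [SimpleGraph.dist_comm]
    refine (SimpleGraph.dist_le (w.drop r)).trans ?_
    rw [SimpleGraph.Walk.drop_length]
    omega

/-- The disks of radius `m a y` about the images `f a` pairwise intersect by the triangle inequality,
and any common vertex is a possible image of `y`. -/
theorem IsHelly.exists_extension_point (hHelly : IsHelly G) (hG : G.Connected)
    {m : X → X → ℕ} (m_comm : ∀ a b, m a b = m b a)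
    (m_triangle : ∀ a b c, m a c ≤ m a b + m b c) {A : Set X} {f : X → V}
    (hf : ∀ a ∈ A, ∀ b ∈ A, G.dist (f a) (f b) ≤ m a b) (y : X) :
    ∃ z, ∀ a ∈ A, G.dist (f a) z ≤ m a y := by
  obtain ⟨z, hz⟩ := hHelly ((fun a => disk G (f a) (m a y)) '' A)
    (by rintro _ ⟨a, -, rfl⟩; exact ⟨_, _, rfl⟩)
    (by
      rintro _ ⟨a, ha, rfl⟩ _ ⟨b, hb, rfl⟩
      exact disk_inter_disk_nonempty hG
        ((hf a ha b hb).trans (m_comm b y ▸ m_triangle a y b)))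
  exact ⟨z, fun a ha => SimpleGraph.dist_comm.trans_le
    ((SimpleGraph.dist_comm (G := G)).trans_le (hz _ ⟨a, ha, rfl⟩))⟩

/-- A 1-Lipschitz map into a Helly graph extends to finitely many further points. The function `m`
need not vanish on the diagonal. -/
theorem IsHelly.exists_extension (hHelly : IsHelly G) (hG : G.Connected)
    {m : X → X → ℕ} (m_comm : ∀ a b, m a b = m b a)
    (m_triangle : ∀ a b c, m a c ≤ m a b + m b c) {A : Set X} {f : X → V}
    (hf : ∀ a ∈ A, ∀ b ∈ A, G.dist (f a) (f b) ≤ m a b) {T : Set X} (hT : T.Finite) :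
    ∃ g : X → V, Set.EqOn g f A ∧ ∀ a ∈ A ∪ T, ∀ b ∈ A ∪ T, G.dist (g a) (g b) ≤ m a b := by
  classical
  induction T, hT using Set.Finite.induction_on with
  | empty => exact ⟨f, fun _ _ => rfl, by simpa using hf⟩
  | @insert y T _ _ ih =>
    obtain ⟨g, hgf, hg⟩ := ih
    by_cases hy : y ∈ A ∪ T
    · refine ⟨g, hgf, ?_⟩
      rwa [Set.union_insert, Set.insert_eq_of_mem hy]
    obtain ⟨z, hz⟩ := hHelly.exists_extension_point hG m_comm m_triangle hg y
    have hne : ∀ a ∈ A ∪ T, a ≠ y := fun a ha h => hy (h ▸ ha)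
    refine ⟨Function.update g y z, fun a ha => ?_, ?_⟩
    · rw [Function.update_of_ne (hne a (Or.inl ha)), hgf ha]
    rw [Set.union_insert]
    rintro a (rfl | ha) b (rfl | hb)
    · simp
    · rw [Function.update_self, Function.update_of_ne (hne b hb), SimpleGraph.dist_comm, m_comm]
      exact hz b hb
    · rw [Function.update_self, Function.update_of_ne (hne a ha)]
      exact hz a ha
    · rw [Function.update_of_ne (hne a ha), Function.update_of_ne (hne b hb)]
      exact hg a ha b hb

/-- The vertices `v i` are placed at heights `t i` above the grid points `c i`. If this placement
does not decrease distances and if any two points `p`, `q` of `S` lie, in some order, on a geodesic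
between two vertices `v i`, `v j` whose distance the placement preserves, then a Helly graph
contains an isometric copy of `S`: a 1-Lipschitz extension to `S` of the placement cannot shorten
the distance between `p` and `q`. -/
theorem IsHelly.containsIsometric_of_anchors (hHelly : IsHelly G) (hG : G.Connected)
    {S : Set (ℤ × ℤ)} (hS : IsGeodesicSet S) (hfin : S.Finite) {ι : Type*} (v : ι → V)
    (c : ι → ℤ × ℤ) (t : ι → ℕ)
    (hle : ∀ i j, G.dist (v i) (v j) ≤ t i + linf (c i) (c j) + t j)
    (hge : ∀ p ∈ S, ∀ q ∈ S, ∃ i j,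
      t i + linf (c i) p + linf p q + linf q (c j) + t j ≤ G.dist (v i) (v j) ∨
      t i + linf (c i) q + linf q p + linf p (c j) + t j ≤ G.dist (v i) (v j)) :
    ContainsIsometric G (kingGrid.induce S) := by
  obtain ⟨v₀⟩ := hG.nonempty
  -- Points of `ι` stand for the `v i`, with their heights; grid points have height zero.
  let pos : ι ⊕ (ℤ × ℤ) → ℤ × ℤ := Sum.elim c id
  let height : ι ⊕ (ℤ × ℤ) → ℕ := Sum.elim t 0
  obtain ⟨g, hgv, hg⟩ := hHelly.exists_extension hG
    (m := fun a b => height a + linf (pos a) (pos b) + height b)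
    (fun a b => by rw [linf_comm]; omega)
    (fun a b d => by have := linf_triangle (pos a) (pos b) (pos d); omega)
    (A := Set.range Sum.inl) (f := Sum.elim v fun _ => v₀)
    (by rintro _ ⟨i, rfl⟩ _ ⟨j, rfl⟩; exact hle i j) (hfin.image Sum.inr)
  have hgi : ∀ i, g (Sum.inl i) = v i := fun i => hgv ⟨i, rfl⟩
  have hmem : ∀ p ∈ S, (Sum.inr p : ι ⊕ (ℤ × ℤ)) ∈ Set.range Sum.inl ∪ Sum.inr '' S :=
    fun p hp => Or.inr ⟨p, hp, rfl⟩
  have key : ∀ p ∈ S, ∀ q ∈ S, ∀ i j,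
      t i + linf (c i) p + linf p q + linf q (c j) + t j ≤ G.dist (v i) (v j) →
      linf p q ≤ G.dist (g (Sum.inr p)) (g (Sum.inr q)) := by
    intro p hp q hq i j h
    have h1 := hg (Sum.inl i) (Or.inl ⟨i, rfl⟩) _ (hmem p hp)
    have h2 := hg _ (hmem q hq) (Sum.inl j) (Or.inl ⟨j, rfl⟩)
    have h3 := hG.dist_triangle (u := v i) (v := g (Sum.inr p)) (w := v j)
    have h4 := hG.dist_triangle (u := g (Sum.inr p)) (v := g (Sum.inr q)) (w := v j)
    simp only [hgi, pos, height, Sum.elim_inl, Sum.elim_inr, id, Pi.zero_apply] at h1 h2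
    omega
  rw [hS.containsIsometric_iff]
  refine ⟨fun p => g (Sum.inr p), fun ⟨p, hp⟩ ⟨q, hq⟩ => le_antisymm ?_ ?_⟩
  · simpa [pos, height] using hg _ (hmem p hp) _ (hmem q hq)
  · obtain ⟨i, j, h | h⟩ := hge p hp q hq
    · exact key p hp q hq i j h
    · rw [linf_comm, SimpleGraph.dist_comm]
      exact key q hq p hp i j h

/-! ### Copies of `H1`, `H2` and `H3` spanned by four vertices -/

theorem finite_of_forall_linf_le {S : Set (ℤ × ℤ)} (n : ℕ) (h : ∀ x y, (x, y) ∈ S →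
    linf (0, 0) (x, y) ≤ n) : S.Finite := by
  refine (Set.finite_Icc ((-n, -n) : ℤ × ℤ) (n, n)).subset ?_
  rintro ⟨x, y⟩ hp
  have := h x y hp
  unfold linf at this
  simp only [Set.mem_Icc, Prod.mk_le_mk]
  omega

theorem finite_H1Set (k : ℕ) : (H1Set k).Finite := by
  rw [H1Set_eq]
  refine finite_of_forall_linf_le k fun x y => ?_
  rw [mem_diamond, linf]
  omega

theorem finite_H2Set (k : ℕ) : (H2Set k).Finite := by
  rw [H2Set_eq]
  refine finite_of_forall_linf_le (k + 1) fun x y => ?_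
  simp only [linf, Set.mem_insert_iff, Prod.mk.injEq, mem_diamond]
  omega

theorem finite_H3Set (k : ℕ) : (H3Set k).Finite := by
  rw [H3Set_eq]
  refine finite_of_forall_linf_le (k + 2) fun x y => ?_
  simp only [linf, Set.mem_insert_iff, Prod.mk.injEq, mem_diamond]
  omega

/-- `p` and `q` lie, in this order, on a King-grid geodesic from `e` to `f` along which the first
coordinate increases in every step. -/
def EastChain (e p q f : ℤ × ℤ) : Prop :=
  (|p.2 - e.2| ≤ p.1 - e.1) ∧ (|q.2 - p.2| ≤ q.1 - p.1) ∧ |f.2 - q.2| ≤ f.1 - q.1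

/-- `p` and `q` lie, in this order, on a King-grid geodesic from `e` to `f` along which the second
coordinate increases in every step. -/
def NorthChain (e p q f : ℤ × ℤ) : Prop :=
  (|p.1 - e.1| ≤ p.2 - e.2) ∧ (|q.1 - p.1| ≤ q.2 - p.2) ∧ |f.1 - q.1| ≤ f.2 - q.2

theorem linf_eq_of_east {p q : ℤ × ℤ} (h : |q.2 - p.2| ≤ q.1 - p.1) :
    (linf p q : ℤ) = q.1 - p.1 := by
  rw [abs_le] at h
  unfold linf; omega

theorem linf_eq_of_north {p q : ℤ × ℤ} (h : |q.1 - p.1| ≤ q.2 - p.2) :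
    (linf p q : ℤ) = q.2 - p.2 := by
  rw [abs_le] at h
  unfold linf; omega

theorem EastChain.linf_add {e p q f : ℤ × ℤ} (h : EastChain e p q f) :
    linf e p + linf p q + linf q f = linf e f := by
  obtain ⟨h1, h2, h3⟩ := h
  have h4 : |f.2 - e.2| ≤ f.1 - e.1 := by
    rw [abs_le] at *; omega
  have := linf_eq_of_east h1
  have := linf_eq_of_east h2
  have := linf_eq_of_east h3
  have := linf_eq_of_east h4
  omega

theorem NorthChain.linf_add {e p q f : ℤ × ℤ} (h : NorthChain e p q f) :
    linf e p + linf p q + linf q f = linf e f := by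
  obtain ⟨h1, h2, h3⟩ := h
  have h4 : |f.1 - e.1| ≤ f.2 - e.2 := by
    rw [abs_le] at *; omega
  have := linf_eq_of_north h1
  have := linf_eq_of_north h2
  have := linf_eq_of_north h3
  have := linf_eq_of_north h4
  omega

/-- The six pairs of distinct indices suffice to see that a placement of four vertices does not
decrease distances. -/
theorem dist_le_of_four {u v w x : V} {e f g h : ℤ × ℤ} {a b c d : ℕ}
    (huv : G.dist u v ≤ a + linf e f + b) (hwx : G.dist w x ≤ c + linf g h + d)
    (huw : G.dist u w ≤ a + linf e g + c) (hux : G.dist u x ≤ a + linf e h + d)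
    (hvw : G.dist v w ≤ b + linf f g + c) (hvx : G.dist v x ≤ b + linf f h + d) (i j : Fin 4) :
    G.dist (![u, v, w, x] i) (![u, v, w, x] j) ≤
      ![a, b, c, d] i + linf (![e, f, g, h] i) (![e, f, g, h] j) + ![a, b, c, d] j := by
  have symm : ∀ {y z : V} {p q : ℤ × ℤ} {s t : ℕ}, G.dist y z ≤ s + linf p q + t →
      G.dist z y ≤ t + linf q p + s := by
    intro y z p q s t h
    rw [SimpleGraph.dist_comm, linf_comm]
    omega
  have self : ∀ {y : V} {p : ℤ × ℤ} {s : ℕ}, G.dist y y ≤ s + linf p p + s := by simp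
  fin_cases i <;> fin_cases j
  exacts [self, huv, huw, hux, symm huv, self, hvw, hvx, symm huw, symm hvw, self, hwx,
    symm hux, symm hvx, symm hwx, self]

/-- Four vertices at heights `a`, `b`, `c`, `d` above the western, eastern, northern and southern
corner of `S` span an isometric copy of `S` in a Helly graph if both diagonal distances are
preserved and any two points of `S` lie on a common geodesic between opposite corners. Pairs of
adjacent corners are exempt if the placement preserves all distances. -/
theorem IsHelly.containsIsometric_of_corners (hHelly : IsHelly G) (hG : G.Connected)
    {S : Set (ℤ × ℤ)} (hS : IsGeodesicSet S) (hfin : S.Finite) {u v w x : V} {e f g h : ℤ × ℤ}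
    {a b c d : ℕ}
    (huv : G.dist u v = a + linf e f + b) (hwx : G.dist w x = c + linf h g + d)
    (huw : G.dist u w ≤ a + linf e g + c) (hux : G.dist u x ≤ a + linf e h + d)
    (hvw : G.dist v w ≤ b + linf f g + c) (hvx : G.dist v x ≤ b + linf f h + d)
    (hge : ∀ p ∈ S, ∀ q ∈ S, (EastChain e p q f ∨ EastChain e q p f ∨
        NorthChain h p q g ∨ NorthChain h q p g) ∨
      (((p = e ∨ p = f) ∧ (q = g ∨ q = h) ∨ (q = e ∨ q = f) ∧ (p = g ∨ p = h)) ∧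
        G.dist u w = a + linf e g + c ∧ G.dist u x = a + linf e h + d ∧
        G.dist v w = b + linf f g + c ∧ G.dist v x = b + linf f h + d)) :
    ContainsIsometric G (kingGrid.induce S) := by
  refine hHelly.containsIsometric_of_anchors hG hS hfin ![u, v, w, x] ![e, f, g, h] ![a, b, c, d]
    (dist_le_of_four huv.le (by rw [hwx, linf_comm]) huw hux hvw hvx) fun p hp q hq => ?_
  have hxw : G.dist x w = d + linf h g + c := by
    rw [SimpleGraph.dist_comm]
    omega
  rcases hge p hp q hq with (hc | hc | hc | hc) | ⟨hc, huw', hux', hvw', hvx'⟩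
  · refine ⟨0, 1, Or.inl ?_⟩
    change a + linf e p + linf p q + linf q f + b ≤ G.dist u v
    have := hc.linf_add
    omega
  · refine ⟨0, 1, Or.inr ?_⟩
    change a + linf e q + linf q p + linf p f + b ≤ G.dist u v
    have := hc.linf_add
    omega
  · refine ⟨3, 2, Or.inl ?_⟩
    change d + linf h p + linf p q + linf q g + c ≤ G.dist x w
    have := hc.linf_add
    omega
  · refine ⟨3, 2, Or.inr ?_⟩
    change d + linf h q + linf q p + linf p g + c ≤ G.dist x w
    have := hc.linf_add
    omega
  · have key : ∀ {y z : V} {p q : ℤ × ℤ} {s t : ℕ}, G.dist y z = s + linf p q + t →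
        s + linf p p + linf p q + linf q q + t ≤ G.dist y z := by
      intro y z p q s t h
      rw [linf_self, linf_self]
      omega
    rcases hc with ⟨rfl | rfl, rfl | rfl⟩ | ⟨rfl | rfl, rfl | rfl⟩
    · exact ⟨0, 2, Or.inl (key huw')⟩
    · exact ⟨0, 3, Or.inl (key hux')⟩
    · exact ⟨1, 2, Or.inl (key hvw')⟩
    · exact ⟨1, 3, Or.inl (key hvx')⟩
    · exact ⟨0, 2, Or.inr (key huw')⟩
    · exact ⟨0, 3, Or.inr (key hux')⟩
    · exact ⟨1, 2, Or.inr (key hvw')⟩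
    · exact ⟨1, 3, Or.inr (key hvx')⟩

/-- Two points of a diamond are compared in the direction in which their coordinates differ most; the
geodesic between them then extends to the opposite corners in that direction. -/
theorem chain_of_mem_diamond {a b c d : ℤ} {e f g h p q : ℤ × ℤ}
    (he : ∀ p ∈ diamond a b c d, |p.2 - e.2| ≤ p.1 - e.1)
    (hf : ∀ p ∈ diamond a b c d, |f.2 - p.2| ≤ f.1 - p.1)
    (hg : ∀ p ∈ diamond a b c d, |g.1 - p.1| ≤ g.2 - p.2)
    (hh : ∀ p ∈ diamond a b c d, |p.1 - h.1| ≤ p.2 - h.2)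
    (hp : p ∈ diamond a b c d) (hq : q ∈ diamond a b c d) :
    EastChain e p q f ∨ EastChain e q p f ∨ NorthChain h p q g ∨ NorthChain h q p g := by
  have : |q.2 - p.2| ≤ q.1 - p.1 ∨ |p.2 - q.2| ≤ p.1 - q.1 ∨ |q.1 - p.1| ≤ q.2 - p.2 ∨
      |p.1 - q.1| ≤ p.2 - q.2 := by
    simp only [abs_le]
    omega
  rcases this with h | h | h | h
  · exact Or.inl ⟨he p hp, h, hf q hq⟩
  · exact Or.inr (Or.inl ⟨he q hq, h, hf p hp⟩)
  · exact Or.inr (Or.inr (Or.inl ⟨hh p hp, h, hg q hq⟩))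
  · exact Or.inr (Or.inr (Or.inr ⟨hh q hq, h, hg p hp⟩))

theorem IsHelly.containsIsometric_H1 (hHelly : IsHelly G) (hG : G.Connected) {n : ℕ}
    {u v w x : V} {a b c d : ℕ}
    (huv : G.dist u v = a + 2 * n + b) (hwx : G.dist w x = c + 2 * n + d)
    (huw : G.dist u w ≤ a + n + c) (hux : G.dist u x ≤ a + n + d)
    (hvw : G.dist v w ≤ b + n + c) (hvx : G.dist v x ≤ b + n + d) :
    ContainsIsometric G (H1 n) := by
  refine hHelly.containsIsometric_of_corners hG (isGeodesicSet_H1Set n) (finite_H1Set n)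
    (e := (-n, 0)) (f := (n, 0)) (g := (0, n)) (h := (0, -n)) (a := a) (b := b) (c := c) (d := d)
    (u := u) (v := v) (w := w) (x := x) ?_ ?_ ?_ ?_ ?_ ?_ fun p hp q hq => Or.inl ?_
  iterate 6 unfold linf; omega
  rw [H1Set_eq] at hp hq
  apply chain_of_mem_diamond _ _ _ _ hp hq <;>
  · rintro ⟨y, z⟩ hy
    rw [mem_diamond] at hy
    rw [abs_le]
    omega

theorem IsHelly.containsIsometric_H2 (hHelly : IsHelly G) (hG : G.Connected) {k : ℕ}
    {u v w x : V} {a b c d : ℕ}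
    (huv : G.dist u v = a + (2 * k + 2) + b) (hwx : G.dist w x = c + (2 * k + 1) + d)
    (huw : G.dist u w ≤ a + (k + 1) + c) (hux : G.dist u x ≤ a + (k + 1) + d)
    (hvw : G.dist v w ≤ b + (k + 1) + c) (hvx : G.dist v x ≤ b + (k + 1) + d) :
    ContainsIsometric G (H2 k) := by
  refine hHelly.containsIsometric_of_corners hG (isGeodesicSet_H2Set k) (finite_H2Set k)
    (e := (-(k + 1), 0)) (f := (k + 1, 0)) (g := (0, k + 1)) (h := (0, -k))
    (a := a) (b := b) (c := c) (d := d)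
    (u := u) (v := v) (w := w) (x := x) ?_ ?_ ?_ ?_ ?_ ?_ fun p hp q hq => Or.inl ?_
  iterate 6 unfold linf; omega
  rw [H2Set_eq] at hp hq
  -- The two corners outside the diamond are the western and the eastern one, so pairs that involve
  -- them lie on geodesics between these two.
  rcases hp with rfl | rfl | hp <;> rcases hq with rfl | rfl | hq
  case inr.inr.inr.inr =>
    apply chain_of_mem_diamond _ _ _ _ hp hq <;>
    · rintro ⟨y, z⟩ hy
      rw [mem_diamond] at hy
      rw [abs_le]
      omega
  all_goals
    clear huv hwx huw hux hvw hvx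
    simp only [EastChain, abs_le, diamond, Set.mem_ofPred_eq] at *
    first
    | exact Or.inl (by omega)
    | exact Or.inr (Or.inl (by omega))

/-- In contrast to `H1` and `H2`, the placement has to preserve the side distances as well. -/
theorem IsHelly.containsIsometric_H3 (hHelly : IsHelly G) (hG : G.Connected) {k : ℕ}
    {u v w x : V} {a b c d : ℕ}
    (huv : G.dist u v = a + (2 * k + 3) + b) (hwx : G.dist w x = c + (2 * k + 3) + d)
    (huw : G.dist u w = a + (k + 2) + c) (hux : G.dist u x = a + (k + 2) + d)
    (hvw : G.dist v w = b + (k + 2) + c) (hvx : G.dist v x = b + (k + 2) + d) :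
    ContainsIsometric G (H3 k) := by
  have h1 : linf (-(k + 1), 0) (0, k + 2) = k + 2 := by unfold linf; omega
  have h2 : linf (-(k + 1), 0) (1, -(k + 1)) = k + 2 := by unfold linf; omega
  have h3 : linf (k + 2, 1) (0, k + 2) = k + 2 := by unfold linf; omega
  have h4 : linf (k + 2, 1) (1, -(k + 1)) = k + 2 := by unfold linf; omega
  have h5 : linf (-(k + 1), 0) (k + 2, 1) = 2 * k + 3 := by unfold linf; omega
  have h6 : linf (1, -(k + 1)) (0, k + 2) = 2 * k + 3 := by unfold linf; omega
  rw [← h1] at huw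
  rw [← h2] at hux
  rw [← h3] at hvw
  rw [← h4] at hvx
  rw [← h5] at huv
  rw [← h6] at hwx
  refine hHelly.containsIsometric_of_corners hG (isGeodesicSet_H3Set k) (finite_H3Set k)
    huv hwx huw.le hux.le hvw.le hvx.le fun p hp q hq => ?_
  rw [and_iff_left (by exact ⟨huw, hux, hvw, hvx⟩)]
  clear huv hwx huw hux hvw hvx
  rw [H3Set_eq] at hp hq
  -- All four corners are outside the diamond, and a western or eastern corner lies on no common
  -- geodesic between opposite corners with a northern or southern one: here the exact side
  -- distances are used.
  rcases hp with rfl | rfl | rfl | rfl | hp <;> rcases hq with rfl | rfl | rfl | rfl | hq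
  case inr.inr.inr.inr.inr.inr.inr.inr =>
    left
    apply chain_of_mem_diamond _ _ _ _ hp hq <;>
    · rintro ⟨y, z⟩ hy
      rw [mem_diamond] at hy
      rw [abs_le]
      omega
  all_goals
    first
    | right; simp; done
    | simp only [EastChain, NorthChain, abs_le, diamond, Set.mem_ofPred_eq] at *
      left
      first
      | exact Or.inl (by omega)
      | exact Or.inr (Or.inl (by omega))
      | exact Or.inr (Or.inr (Or.inl (by omega)))
      | exact Or.inr (Or.inr (Or.inr (by omega)))

/-! ### Vertex quadruples of large hyperbolicity -/

/-- As distances are integers, half-integer bounds on the hyperbolicity are inequalities between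
natural numbers. -/
theorem hb_le_half_iff [Finite V] (G : SimpleGraph V) (m : ℕ) :
    hb G ≤ (m : ℝ) / 2 ↔ ∀ u v w x : V,
      G.dist u x + G.dist v w ≤ G.dist u w + G.dist v x →
      G.dist u w + G.dist v x ≤ G.dist u v + G.dist w x →
      G.dist u v + G.dist w x ≤ G.dist u w + G.dist v x + m := by
  have cast : ∀ a b : ℕ, (a : ℝ) - b ≤ m ↔ a ≤ b + m := fun a b => by
    rw [sub_le_iff_le_add']; exact_mod_cast Iff.rfl
  constructor
  · intro h u v w x h1 h2
    rw [← cast]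
    linarith [(isLeast_hb G).1.2 u v w x h1 h2]
  · intro h
    refine (isLeast_hb G).2 ⟨by positivity, fun u v w x h1 h2 => ?_⟩
    rw [mul_div_cancel₀ _ (two_ne_zero' ℝ), cast]
    exact h u v w x h1 h2

/-- The numbers stand for the distances between four vertices `u`, `v`, `w`, `x`. The height over `u`
is half of `uw + ux - wx`, rounded down, and the parity of this number decides which of the two diagonals is the
longer one. The other heights are determined by the height over `u` and by the requirement that the
diagonals `uv`, `wx` and the side `uw` are preserved. -/
theorem exists_heights_H2 {k uv wx uw vx ux vw : ℕ}
    (h1 : ux + vw ≤ uw + vx) (h2 : uw + vx + (2 * k + 1) ≤ uv + wx)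
    (t1 : wx ≤ uw + ux) (t2 : wx ≤ vw + vx) (t3 : uv ≤ uw + vw) (t4 : uv ≤ ux + vx) :
    ∃ l m, (l = 2 * k + 2 ∧ m = 2 * k + 1 ∨ l = 2 * k + 1 ∧ m = 2 * k + 2) ∧
    ∃ a b c d, uv = a + l + b ∧ wx = c + m + d ∧ uw ≤ a + (k + 1) + c ∧
      ux ≤ a + (k + 1) + d ∧ vw ≤ b + (k + 1) + c ∧ vx ≤ b + (k + 1) + d := by
  rcases Nat.even_or_odd' (uw + ux - wx) with ⟨α, h | h⟩
  · exact ⟨2 * k + 1, 2 * k + 2, by omega, α, uv - (2 * k + 1) - α, uw - (k + 1) - α,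
      wx - (2 * k + 2) - (uw - (k + 1) - α), by omega⟩
  · exact ⟨2 * k + 2, 2 * k + 1, by omega, α, uv - (2 * k + 2) - α, uw - (k + 1) - α,
      wx - (2 * k + 1) - (uw - (k + 1) - α), by omega⟩

/-- Heights over the corners of `H1 (k + 1)` exist unless `uw + ux - wx` is odd and there is no slack
in the hypotheses, that is, `ux + vw = uw + vx` and `uv + wx = uw + vx + 2 * k + 2`. In this
exceptional case all distances can be preserved over the corners of `H3 k`. -/
theorem exists_heights_H1_or_H3 {k uv wx uw vx ux vw : ℕ}
    (h1 : ux + vw ≤ uw + vx) (h2 : uw + vx + (2 * k + 2) ≤ uv + wx)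
    (t1 : wx ≤ uw + ux) (t2 : wx ≤ vw + vx) (t3 : uv ≤ uw + vw) (t4 : uv ≤ ux + vx) :
    (∃ a b c d, uv = a + 2 * (k + 1) + b ∧ wx = c + 2 * (k + 1) + d ∧ uw ≤ a + (k + 1) + c ∧
      ux ≤ a + (k + 1) + d ∧ vw ≤ b + (k + 1) + c ∧ vx ≤ b + (k + 1) + d) ∨
    (∃ a b c d, uv = a + (2 * k + 3) + b ∧ wx = c + (2 * k + 3) + d ∧ uw = a + (k + 2) + c ∧
      ux = a + (k + 2) + d ∧ vw = b + (k + 2) + c ∧ vx = b + (k + 2) + d) := by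
  rcases Nat.even_or_odd' (uw + ux - wx) with ⟨α, h | h⟩
  · exact Or.inl ⟨α, uv - 2 * (k + 1) - α, uw - (k + 1) - α,
      wx - 2 * (k + 1) - (uw - (k + 1) - α), by omega⟩
  -- An odd value is corrected by one, which uses up slack in one of the two inequalities.
  by_cases h3 : uw + vx + (2 * k + 2) = uv + wx
  · by_cases h4 : ux + vw = uw + vx
    · exact Or.inr ⟨α, uv - (2 * k + 3) - α, uw - (k + 2) - α,
        wx - (2 * k + 3) - (uw - (k + 2) - α), by omega⟩
    · exact Or.inl ⟨α + 1, uv - 2 * (k + 1) - (α + 1), uw - (k + 1) - (α + 1),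
        wx - 2 * (k + 1) - (uw - (k + 1) - (α + 1)), by omega⟩
  · exact Or.inl ⟨α + 1, uv - 2 * (k + 1) - (α + 1), uw - k - (α + 1),
      wx - 2 * (k + 1) - (uw - k - (α + 1)), by omega⟩

theorem IsHelly.hb_le_iff_H2 [Finite V] (hHelly : IsHelly G) (hG : G.Connected) (k : ℕ) :
    hb G ≤ (k : ℝ) ↔ ¬ContainsIsometric G (H2 k) := by
  have hk : (k : ℝ) = ((2 * k : ℕ) : ℝ) / 2 := by push_cast; ring
  rw [hk, hb_le_half_iff]
  constructor
  · intro h hc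
    obtain ⟨f, hf⟩ := (isGeodesicSet_H2Set k).containsIsometric_iff.1 hc
    have he : (-(k + 1 : ℤ), (0 : ℤ)) ∈ H2Set k := by simp [H2Set_eq]
    have hf' : ((k + 1 : ℤ), (0 : ℤ)) ∈ H2Set k := by simp [H2Set_eq]
    have hg : ((0 : ℤ), (k + 1 : ℤ)) ∈ H2Set k := by
      rw [H2Set_eq]; exact Or.inr (Or.inr (by rw [mem_diamond]; omega))
    have hh : ((0 : ℤ), (-k : ℤ)) ∈ H2Set k := by
      rw [H2Set_eq]; exact Or.inr (Or.inr (by rw [mem_diamond]; omega))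
    have := h (f ⟨_, he⟩) (f ⟨_, hf'⟩) (f ⟨_, hg⟩) (f ⟨_, hh⟩)
    simp only [hf, linf] at this
    omega
  · contrapose!
    rintro ⟨u, v, w, x, h1, h2, h3⟩
    have t1 := hG.dist_triangle (u := w) (v := u) (w := x)
    have t2 := hG.dist_triangle (u := w) (v := v) (w := x)
    have t3 := hG.dist_triangle (u := u) (v := w) (w := v)
    have t4 := hG.dist_triangle (u := u) (v := x) (w := v)
    rw [G.dist_comm (u := w) (v := u)] at t1
    rw [G.dist_comm (u := w) (v := v)] at t2 t3
    rw [G.dist_comm (u := x) (v := v)] at t4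
    obtain ⟨l, m, ⟨rfl, rfl⟩ | ⟨rfl, rfl⟩, a, b, c, d, huv, hwx, huw, hux, hvw, hvx⟩ :=
      exists_heights_H2 (k := k) h1 (by omega) t1 t2 t3 t4
    · exact hHelly.containsIsometric_H2 hG huv hwx huw hux hvw hvx
    · rw [SimpleGraph.dist_comm] at huw hux hvw hvx
      exact hHelly.containsIsometric_H2 hG hwx huv (a := c) (b := d) (c := a) (d := b)
        (by omega) (by omega) (by omega) (by omega)

theorem IsHelly.hb_le_iff_H1_H3 [Finite V] (hHelly : IsHelly G) (hG : G.Connected) (k : ℕ) :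
    hb G ≤ (k : ℝ) + 1 / 2 ↔
      ¬ContainsIsometric G (H1 (k + 1)) ∧ ¬ContainsIsometric G (H3 k) := by
  have hk : (k : ℝ) + 1 / 2 = ((2 * k + 1 : ℕ) : ℝ) / 2 := by push_cast; ring
  rw [hk, hb_le_half_iff]
  constructor
  · intro h
    constructor
    · intro hc
      obtain ⟨f, hf⟩ := (isGeodesicSet_H1Set (k + 1)).containsIsometric_iff.1 hc
      have he : (-(k + 1 : ℤ), (0 : ℤ)) ∈ H1Set (k + 1) := by
        rw [H1Set_eq, mem_diamond]; omega
      have hf' : ((k + 1 : ℤ), (0 : ℤ)) ∈ H1Set (k + 1) := by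
        rw [H1Set_eq, mem_diamond]; omega
      have hg : ((0 : ℤ), (k + 1 : ℤ)) ∈ H1Set (k + 1) := by
        rw [H1Set_eq, mem_diamond]; omega
      have hh : ((0 : ℤ), (-(k + 1) : ℤ)) ∈ H1Set (k + 1) := by
        rw [H1Set_eq, mem_diamond]; omega
      have := h (f ⟨_, he⟩) (f ⟨_, hf'⟩) (f ⟨_, hg⟩) (f ⟨_, hh⟩)
      simp only [hf, linf] at this
      omega
    · intro hc
      obtain ⟨f, hf⟩ := (isGeodesicSet_H3Set k).containsIsometric_iff.1 hc
      have he : (-(k + 1 : ℤ), (0 : ℤ)) ∈ H3Set k := by simp [H3Set_eq]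
      have hf' : ((k + 2 : ℤ), (1 : ℤ)) ∈ H3Set k := by simp [H3Set_eq]
      have hg : ((0 : ℤ), (k + 2 : ℤ)) ∈ H3Set k := by simp [H3Set_eq]
      have hh : ((1 : ℤ), (-(k + 1) : ℤ)) ∈ H3Set k := by simp [H3Set_eq]
      have := h (f ⟨_, he⟩) (f ⟨_, hf'⟩) (f ⟨_, hg⟩) (f ⟨_, hh⟩)
      simp only [hf, linf] at this
      omega
  · contrapose!
    rintro ⟨u, v, w, x, h1, h2, h3⟩ hnot
    have t1 := hG.dist_triangle (u := w) (v := u) (w := x)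
    have t2 := hG.dist_triangle (u := w) (v := v) (w := x)
    have t3 := hG.dist_triangle (u := u) (v := w) (w := v)
    have t4 := hG.dist_triangle (u := u) (v := x) (w := v)
    rw [G.dist_comm (u := w) (v := u)] at t1
    rw [G.dist_comm (u := w) (v := v)] at t2 t3
    rw [G.dist_comm (u := x) (v := v)] at t4
    rcases exists_heights_H1_or_H3 (k := k) h1 (by omega) t1 t2 t3 t4 with
      ⟨a, b, c, d, huv, hwx, huw, hux, hvw, hvx⟩ | ⟨a, b, c, d, huv, hwx, huw, hux, hvw, hvx⟩
    · exact absurd (hHelly.containsIsometric_H1 hG huv hwx huw hux hvw hvx) hnot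
    · exact hHelly.containsIsometric_H3 hG huv hwx huw hux hvw hvx

end HellyHyp

theorem mainTheorem3 {V : Type*} [Finite V] (G : SimpleGraph V) (hconn : G.Connected)
    (hHelly : HellyHyp.IsHelly G) (k : ℕ) :
    (HellyHyp.hb G ≤ (k : ℝ) ↔ ¬ HellyHyp.ContainsIsometric G (HellyHyp.H2 k)) ∧
    (HellyHyp.hb G ≤ (k : ℝ) + 1 / 2 ↔
      ¬ HellyHyp.ContainsIsometric G (HellyHyp.H1 (k + 1)) ∧
      ¬ HellyHyp.ContainsIsometric G (HellyHyp.H3 k)) :=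
  ⟨hHelly.hb_le_iff_H2 hconn k, hHelly.hb_le_iff_H1_H3 hconn k⟩
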